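/- Let $(\alpha_k)_{k\ge 0}$ and $(\beta_k)_{k\ge 0}$ be real sequences with $\beta_k>0$ for all $k$ and $$\sum_{k=0}^\infty\Big(\big|\beta_k-\tfrac12\big|+|\alpha_k|\Big)<\infty ,$$ and let $J$ be the bounded Jacobi operator on $\ell^2(\mathbb N_0)$ with diagonal $(\alpha_k)$ and off-diagonals $(\beta_k)$ (so $J=\Delta+K$, with $K$ trace class and $\Delta$ the free Jacobi operator, which has diagonal $0$ and off-diagonals $\tfrac12$). Let $G(\lambda)=\langle e_0,(J-\lambda)^{-1}e_0\rangle$, $\lambda\in\mathbb C\setminus\sigma(J)$, be its principal resolvent. Let $P_k$ be the orthonormal polynomials of $J$, given by $P_{-1}=0$, $P_0=1$, $sP_k=\beta_{k-1}P_{k-1}+\alpha_kP_k+\beta_kP_{k+1}$ for $k\ge 0$, and let $P_k^\mu$ be the first associated polynomials, given by $P^\mu_0=0$, $P^\mu_1=\beta_0^{-1}$ and $sP^\mu_k=\beta_{k-1}P^\mu_{k-1}+\alpha_kP^\mu_k+\beta_kP^\mu_{k+1}$ for $k\ge1$. Let $U_k$ be the Chebyshev polynomials of the second kind, which are the orthonormal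 polynomials of $\Delta$. Let $C=(c_{ij})$ and $C^\mu=(c^\mu_{ij})$ be the upper triangular connection coefficient matrices, defined by $P_k=\sum_{i\le k}c_{ik}U_i$ and $P^\mu_k=\sum_{i\le k}c^\mu_{ik}U_i$. Then the limits $t_k=\lim_{i\to\infty}c_{i,i+k}$ and $t^\mu_k=\lim_{i\to\infty}c^\mu_{i,i+k}$ exist for every $k\ge 0$, and the symbols of the Toeplitz parts of $C$ and $C^\mu$, $$c(z)=\sum_{k=0}^\infty t_kz^k,\qquad c_\mu(z)=\sum_{k=0}^\infty t^\mu_kz^k ,$$ converge and are analytic in the open unit disc $\mathbb D$. Write $\lambda(z)=\frac12(z+z^{-1})$. For every $z\in\mathbb D\setminus\{0\}$ with $\lambda(z)\notin\sigma(J)$ we have $c(z)\ne0$, and the principal resolvent is given by the meromorphic function $$G(\lambda(z))=-\frac{c_\mu(z)}{c(z)} .$$ Moreover, every eigenvalue of $J$ other than $\pm1$ is of the form $\lambda(z_k)$, where $z_k\in\mathbb D\setminus\{0\}$ is a root of $c$. -/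

import Mathlib

open Filter Topology Polynomial

/-! ### The bounded Jacobi operator with given coefficients -/

/-- The formal action on sequences of the Jacobi matrix with diagonal `α` and off-diagonal `β`:
`(J v)_0 = α_0 v_0 + β_0 v_1` and `(J v)_k = β_{k-1} v_{k-1} + α_k v_k + β_k v_{k+1}`. -/
def jacobiAction (α β : ℕ → ℝ) (v : ℕ → ℂ) : ℕ → ℂ
  | 0 => α 0 * v 0 + β 0 * v 1
  | k + 1 => β k * v k + α (k + 1) * v (k + 1) + β (k + 1) * v (k + 2)

/-- Boundedness of the coefficients, so that the Jacobi matrix acts boundedly on `ℓ²`. -/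
def BoundedCoeffs (α β : ℕ → ℝ) : Prop := ∃ M : ℝ, ∀ k, |α k| ≤ M ∧ |β k| ≤ M

theorem memlp_two_iff (v : ℕ → ℂ) :
    Memℓp v 2 ↔ Summable fun k => ‖v k‖ ^ 2 := by
  rw [memℓp_gen_iff (by norm_num)]
  norm_num

theorem memlp_jacobiAction {α β : ℕ → ℝ} (h : BoundedCoeffs α β) {v : ℕ → ℂ}
    (hv : Memℓp v 2) : Memℓp (jacobiAction α β v) 2 := by
  obtain ⟨M, hM⟩ := h
  have hM0 : 0 ≤ M := (abs_nonneg _).trans (hM 0).1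
  rw [memlp_two_iff] at hv ⊢
  rw [← summable_nat_add_iff 1]
  have h1 : Summable fun k => ‖v (k + 1)‖ ^ 2 := (summable_nat_add_iff 1).2 hv
  have h2 : Summable fun k => ‖v (k + 2)‖ ^ 2 := (summable_nat_add_iff 2).2 hv
  refine Summable.of_nonneg_of_le (fun _ => by positivity) (fun k => ?_)
    (((hv.add h1).add h2).mul_left (3 * M ^ 2))
  have hb : ‖jacobiAction α β v (k + 1)‖ ≤ M * (‖v k‖ + ‖v (k + 1)‖ + ‖v (k + 2)‖) := by
    have e1 : ‖(β k : ℂ) * v k‖ ≤ M * ‖v k‖ := by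
      rw [norm_mul, Complex.norm_real, Real.norm_eq_abs]
      exact mul_le_mul_of_nonneg_right (hM k).2 (norm_nonneg _)
    have e2 : ‖(α (k + 1) : ℂ) * v (k + 1)‖ ≤ M * ‖v (k + 1)‖ := by
      rw [norm_mul, Complex.norm_real, Real.norm_eq_abs]
      exact mul_le_mul_of_nonneg_right (hM (k + 1)).1 (norm_nonneg _)
    have e3 : ‖(β (k + 1) : ℂ) * v (k + 2)‖ ≤ M * ‖v (k + 2)‖ := by
      rw [norm_mul, Complex.norm_real, Real.norm_eq_abs]
      exact mul_le_mul_of_nonneg_right (hM (k + 1)).2 (norm_nonneg _)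
    have := norm_add₃_le (a := (β k : ℂ) * v k) (b := (α (k + 1) : ℂ) * v (k + 1))
      (c := (β (k + 1) : ℂ) * v (k + 2))
    simp only [jacobiAction]
    linarith
  calc ‖jacobiAction α β v (k + 1)‖ ^ 2
      ≤ (M * (‖v k‖ + ‖v (k + 1)‖ + ‖v (k + 2)‖)) ^ 2 := by gcongr
    _ = M ^ 2 * (‖v k‖ + ‖v (k + 1)‖ + ‖v (k + 2)‖) ^ 2 := by ring
    _ ≤ M ^ 2 * (3 * (‖v k‖ ^ 2 + ‖v (k + 1)‖ ^ 2 + ‖v (k + 2)‖ ^ 2)) := by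
        gcongr
        nlinarith [sq_nonneg (‖v k‖ - ‖v (k + 1)‖), sq_nonneg (‖v k‖ - ‖v (k + 2)‖),
          sq_nonneg (‖v (k + 1)‖ - ‖v (k + 2)‖)]
    _ = _ := by ring

/-- The Jacobi matrix as a linear map on `ℓ²(ℕ, ℂ)`. -/
def jacobiLinearMap (α β : ℕ → ℝ) (h : BoundedCoeffs α β) :
    lp (fun _ : ℕ => ℂ) 2 →ₗ[ℂ] lp (fun _ : ℕ => ℂ) 2 where
  toFun v := ⟨jacobiAction α β v, memlp_jacobiAction h (lp.memℓp v)⟩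
  map_add' v w := by
    apply lp.ext
    funext k
    change jacobiAction α β (⇑v + ⇑w) k = jacobiAction α β v k + jacobiAction α β w k
    cases k <;> simp only [jacobiAction, Pi.add_apply] <;> ring
  map_smul' a v := by
    apply lp.ext
    funext k
    change jacobiAction α β (a • ⇑v) k = a • jacobiAction α β v k
    cases k <;> simp only [jacobiAction, Pi.smul_apply, smul_eq_mul] <;> ring

theorem continuous_jacobiAction_apply (α β : ℕ → ℝ) (k : ℕ) :
    Continuous fun v : lp (fun _ : ℕ => ℂ) 2 => jacobiAction α β v k := by
  have hc : ∀ i : ℕ, Continuous fun v : lp (fun _ : ℕ => ℂ) 2 => v i :=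
    fun i => (lp.evalCLM ℂ (fun _ : ℕ => ℂ) 2 i).continuous
  cases k with
  | zero => exact (continuous_const.mul (hc 0)).add (continuous_const.mul (hc 1))
  | succ k =>
    exact ((continuous_const.mul (hc k)).add (continuous_const.mul (hc (k + 1)))).add
      (continuous_const.mul (hc (k + 2)))

/-- The Jacobi operator `J` on `ℓ²(ℕ, ℂ)` with bounded diagonal `α` and off-diagonal `β`, as a
bounded operator; `jacobiOperator_apply` below is its matrix action. -/
noncomputable def jacobiOperator (α β : ℕ → ℝ) (h : BoundedCoeffs α β) :
    lp (fun _ : ℕ => ℂ) 2 →L[ℂ] lp (fun _ : ℕ => ℂ) 2 :=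
  ContinuousLinearMap.ofSeqClosedGraph (g := jacobiLinearMap α β h) (by
    intro u x y hu hy
    apply lp.ext
    funext k
    have h1 := ((lp.evalCLM ℂ (fun _ : ℕ => ℂ) 2 k).continuous.tendsto y).comp hy
    have h2 := ((continuous_jacobiAction_apply α β k).tendsto x).comp hu
    exact tendsto_nhds_unique h1 h2)

theorem jacobiOperator_apply (α β : ℕ → ℝ) (h : BoundedCoeffs α β)
    (v : lp (fun _ : ℕ => ℂ) 2) (k : ℕ) :
    jacobiOperator α β h v k = jacobiAction α β v k := rfl

/-- `J` is a Toeplitz-plus-trace-class Jacobi operator, `J = Δ + K` with `K` trace class and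
`Δ` the free Jacobi operator (zero diagonal, off-diagonal `1/2`). -/
def IsToeplitzPlusTraceClass (α β : ℕ → ℝ) : Prop :=
  Summable fun k => |β k - 1 / 2| + |α k|

theorem IsToeplitzPlusTraceClass.boundedCoeffs {α β : ℕ → ℝ}
    (h : IsToeplitzPlusTraceClass α β) : BoundedCoeffs α β := by
  refine ⟨(∑' k, (|β k - 1 / 2| + |α k|)) + 1 / 2, fun k => ?_⟩
  have h1 := h.le_tsum k (fun _ _ => by positivity)
  have h2 := abs_nonneg (β k - 1 / 2)
  have h3 := abs_nonneg (α k)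
  refine ⟨by linarith, ?_⟩
  have h4 := abs_add_le (β k - 1 / 2) (1 / 2)
  rw [sub_add_cancel, abs_of_pos (by norm_num : (0 : ℝ) < 1 / 2)] at h4
  linarith

/-- The vector `e_0` of `ℓ²`. -/
noncomputable def e0 : lp (fun _ : ℕ => ℂ) 2 := lp.single 2 0 1

/-- The principal resolvent `G(lam) = ⟨e_0, (J - lam)⁻¹ e_0⟩`, meaningful for `lam ∉ σ(J)`. -/
noncomputable def principalResolvent
    (J : lp (fun _ : ℕ => ℂ) 2 →L[ℂ] lp (fun _ : ℕ => ℂ) 2) (lam : ℂ) : ℂ :=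
  inner ℂ e0
    (Ring.inverse (J - algebraMap ℂ (lp (fun _ : ℕ => ℂ) 2 →L[ℂ] lp (fun _ : ℕ => ℂ) 2) lam) e0)

/-- The Joukowski map `z ↦ (z + z⁻¹) / 2`, meaningful for `z ≠ 0`. -/
noncomputable def joukowski (z : ℂ) : ℂ := (z + z⁻¹) / 2

/-! ### Orthonormal polynomials and first associated polynomials -/

/-- The orthonormal polynomials: `P_0 = 1` and
`s P_k = β_{k-1} P_{k-1} + α_k P_k + β_k P_{k+1}` (with `P_{-1} = 0`), for `β` nonvanishing. -/
noncomputable def orthPoly (α β : ℕ → ℝ) : ℕ → ℝ[X]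
  | 0 => 1
  | 1 => C (β 0)⁻¹ * (X - C (α 0))
  | k + 2 => C (β (k + 1))⁻¹ *
      ((X - C (α (k + 1))) * orthPoly α β (k + 1) - C (β k) * orthPoly α β k)

/-- The first associated polynomials: `P^μ_0 = 0`, `P^μ_1 = β_0⁻¹`, with the same three-term
recurrence for `k ≥ 1`. -/
noncomputable def assocPoly (α β : ℕ → ℝ) : ℕ → ℝ[X]
  | 0 => 0
  | 1 => C (β 0)⁻¹
  | k + 2 => C (β (k + 1))⁻¹ *
      ((X - C (α (k + 1))) * assocPoly α β (k + 1) - C (β k) * assocPoly α β k)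

theorem degree_recurrence {b a b' : ℝ} (hb : b ≠ 0) {p q : ℝ[X]} {n : ℕ}
    (hp : p.degree = (n : WithBot ℕ)) (hq : q.degree < ((n + 1 : ℕ) : WithBot ℕ)) :
    (C b⁻¹ * ((X - C a) * p - C b' * q)).degree = ((n + 1 : ℕ) : WithBot ℕ) := by
  have h1 : ((X - C a) * p).degree = ((n + 1 : ℕ) : WithBot ℕ) := by
    rw [degree_mul, degree_X_sub_C, hp]
    push_cast
    exact add_comm _ _
  have h2 : (C b' * q).degree < ((n + 1 : ℕ) : WithBot ℕ) := by
    rcases eq_or_ne b' 0 with h | h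
    · rw [h, C_0, zero_mul, degree_zero]
      exact WithBot.bot_lt_coe _
    · rwa [degree_C_mul h]
  rw [degree_C_mul (inv_ne_zero hb), degree_sub_eq_left_of_degree_lt (by rwa [h1]), h1]

theorem degree_orthPoly {α β : ℕ → ℝ} (hβ : ∀ k, 0 < β k) :
    ∀ k, (orthPoly α β k).degree = k
  | 0 => by simp [orthPoly]
  | 1 => by
    rw [orthPoly, degree_C_mul (inv_ne_zero (hβ 0).ne'), degree_X_sub_C]
    norm_num
  | k + 2 => by
    rw [orthPoly]
    refine degree_recurrence (hβ _).ne' (degree_orthPoly hβ (k + 1)) ?_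
    rw [degree_orthPoly hβ k]
    exact_mod_cast (by omega : k < k + 1 + 1)

/-- The orthonormal polynomials as a sequence of polynomials with `deg P_k = k`. -/
noncomputable def orthPolySequence (α β : ℕ → ℝ) (hβ : ∀ k, 0 < β k) :
    Polynomial.Sequence ℝ where
  elems' := orthPoly α β
  degree_eq' := degree_orthPoly hβ

/-- The orthonormal polynomials of the free Jacobi operator `Δ` (the Chebyshev polynomials of the
second kind). -/
noncomputable def freePolySequence : Polynomial.Sequence ℝ :=
  orthPolySequence (fun _ => 0) (fun _ => 1 / 2) (fun _ => by norm_num)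

/-! ### Connection coefficients and Toeplitz symbols -/

/-- The connection coefficient matrix `(c_{ik})` from the polynomials `p` to the polynomial
sequence `Q`: `c_{ik}` is the coefficient of `Q_i` in the expansion of `p_k` in the basis
`Q_0, Q_1, …`, so that `p_k = c_{0k} Q_0 + c_{1k} Q_1 + ⋯ + c_{kk} Q_k` when `deg p_k ≤ k`. -/
noncomputable def connectionMatrix (p : ℕ → ℝ[X]) (Q : Polynomial.Sequence ℝ) (i k : ℕ) : ℝ :=
  (Q.basis (fun j => (leadingCoeff_ne_zero.2 (Q.ne_zero j)).isUnit)).repr (p k) i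

theorem connectionMatrix_upper {p : ℕ → ℝ[X]} (Q : Polynomial.Sequence ℝ) {i k : ℕ}
    (hp : (p k).degree ≤ (k : WithBot ℕ)) (hik : k < i) : connectionMatrix p Q i k = 0 := by
  have hQ : ∀ j, IsUnit (Q j).leadingCoeff :=
    fun j => (leadingCoeff_ne_zero.2 (Q.ne_zero j)).isUnit
  have h1 : p k ∈ Submodule.span ℝ (Q.basis hQ '' Set.Iic k) := by
    have : (Q.basis hQ : ℕ → ℝ[X]) = Q := funext fun j => Q.basis_eq_self hQ j
    rw [this, Q.span_degreeLE (fun j _ => hQ j)]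
    exact mem_degreeLE.2 hp
  have h2 := (Q.basis hQ).mem_span_image.1 h1
  by_contra h
  exact absurd (h2 (Finsupp.mem_support_iff.2 h)) (by simpa using hik)

theorem connectionMatrix_expansion {p : ℕ → ℝ[X]} (Q : Polynomial.Sequence ℝ) {k : ℕ}
    (hp : (p k).degree ≤ (k : WithBot ℕ)) :
    p k = ∑ i ∈ Finset.range (k + 1), connectionMatrix p Q i k • Q i := by
  have hQ : ∀ j, IsUnit (Q j).leadingCoeff :=
    fun j => (leadingCoeff_ne_zero.2 (Q.ne_zero j)).isUnit
  have h1 := (Q.basis hQ).linearCombination_repr (p k)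
  rw [Finsupp.linearCombination_apply, Finsupp.sum_of_support_subset
    (s := Finset.range (k + 1))] at h1
  · rw [← h1]
    refine Finset.sum_congr rfl fun i _ => ?_
    rw [Q.basis_eq_self hQ]
    rfl
  · intro i hi
    by_contra h
    exact Finsupp.mem_support_iff.1 hi (connectionMatrix_upper Q hp (by simpa using h))
  · simp

/-- The connection coefficient matrix `C = C_{J → Δ}`. -/
noncomputable def connC (α β : ℕ → ℝ) : ℕ → ℕ → ℝ :=
  connectionMatrix (orthPoly α β) freePolySequence

/-- The connection coefficient matrix `C^μ = C^μ_{J → Δ}` of the first associated polynomials. -/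
noncomputable def connCmu (α β : ℕ → ℝ) : ℕ → ℕ → ℝ :=
  connectionMatrix (assocPoly α β) freePolySequence

/-- The `k`-th coefficient `t_k = lim_i a_{i,i+k}` of the upper triangular Toeplitz part of an
upper triangular matrix `(a_{ij})`, meaningful when the limit exists. -/
noncomputable def toeplitzCoeff (A : ℕ → ℕ → ℝ) (k : ℕ) : ℝ :=
  limUnder atTop fun i => A i (i + k)

/-- The symbol `∑_k t_k z^k` of the Toeplitz part, meaningful where the series converges. -/
noncomputable def toeplitzSymbol (A : ℕ → ℕ → ℝ) (z : ℂ) : ℂ :=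
  ∑' k, (toeplitzCoeff A k : ℂ) * z ^ k

/-! Since `(1 - z²) z^i U_i(λ(z)) = 1 - z^(2i+2)`, the coefficient of `z^j` in `(1 - z²) z^k
P_k(λ(z))` is `c_{k-j,k}` for `j ≤ k`. The Toeplitz limits are therefore coefficientwise limits of
these polynomials, and likewise for `P^μ`.

The limits come from a perturbation argument. With `A_k = ∏_{i<k} 2β_i`, the polynomials `Q_k = A_k
z^k P_k(λ(z))` satisfy the free recurrence up to summable errors
(`IsRecurrenceSolution.isPerturbedGeometric`). A discrete Gronwall estimate bounds their
coefficients by `M / r^j` uniformly in `k` for each `r < 1`, and `Q_{k+1} - z² Q_k` has summable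
increments. Hence the coefficients converge, and by dominated convergence `(1 - z²) z^k P_k(λ(z)) →
c(z)` for `0 < |z| < 1` (`tendsto_toeplitzSymbol`).

A solution of `(J - λ(z)) v = d e_0` is `v_0 P + d P^μ`. If `v → 0`, multiplying by `(1 - z²) z^k`
and passing to the limit gives `v_0 c(z) + d c_μ(z) = 0` (`toeplitzSymbol_relation`). For `d = 1`,
where `v_0 = G`, this is the resolvent formula; for `d = 0` it makes `c` vanish at eigenvalues.

Two points remain. If `c(z) = 0`, then `P_k(λ(z))` is bounded, so its Wronskian with the resolvent
vector tends to `0`, although it is constantly `-1`. If `|z| = 1` and `z ≠ ±1`, a solution tending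
to `0` vanishes identically, so such `λ(z)` is no eigenvalue. -/

/-! ### Rescaled polynomials and connection coefficients. -/

/-- The polynomial `z ↦ z ^ k * p ((z + z⁻¹) / 2)`, for `p` of degree at most `k`. -/
noncomputable def scaledPoly (p : ℝ[X]) (k : ℕ) : ℝ[X] :=
  ∑ i ∈ Finset.range (k + 1), C (p.coeff i) * (C (1 / 2) * (X ^ 2 + 1)) ^ i * X ^ (k - i)

/-- The field is general because real points serve to prove polynomial identities and complex points
to take limits. -/
theorem aeval_scaledPoly {K : Type*} [Field K] [Algebra ℝ K] {p : ℝ[X]} {k : ℕ}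
    (hp : p.degree ≤ (k : WithBot ℕ)) {z : K} (hz : z ≠ 0) :
    aeval z (scaledPoly p k) = z ^ k * aeval ((z + z⁻¹) / 2) p := by
  have hk : p.natDegree < k + 1 := Nat.lt_succ_of_le (natDegree_le_of_degree_le hp)
  have h2 : (algebraMap ℝ K) 2 = 2 := map_ofNat _ 2
  rw [aeval_eq_sum_range' hk, scaledPoly, map_sum, Finset.mul_sum]
  refine Finset.sum_congr rfl fun i hi => ?_
  have hik : i ≤ k := Nat.lt_succ_iff.1 (Finset.mem_range.1 hi)
  obtain ⟨m, rfl⟩ := Nat.exists_eq_add_of_le hik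
  simp only [map_mul, map_pow, map_add, map_one, aeval_C, aeval_X, Nat.add_sub_cancel_left,
    Algebra.smul_def, one_div, map_inv₀, h2]
  rw [show (2 : K)⁻¹ * (z ^ 2 + 1) = z * ((z + z⁻¹) / 2) by field_simp, mul_pow, pow_add]
  ring

/-- The solutions, in polynomials of degree at most `k`, of the three-term recurrence of the
Jacobi matrix away from its first row. -/
structure IsRecurrenceSolution (α β : ℕ → ℝ) (P : ℕ → ℝ[X]) : Prop where
  degree_le : ∀ k : ℕ, (P k).degree ≤ (k : WithBot ℕ)
  recurrence : ∀ k, C (β (k + 1)) * P (k + 2) =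
    (X - C (α (k + 1))) * P (k + 1) - C (β k) * P k

theorem C_mul_C_inv_mul {b : ℝ} (hb : 0 < b) (p : ℝ[X]) : C b * (C b⁻¹ * p) = p := by
  rw [← mul_assoc, ← C_mul, mul_inv_cancel₀ hb.ne', C_1, one_mul]

theorem isRecurrenceSolution_orthPoly {α β : ℕ → ℝ} (hβ : ∀ k, 0 < β k) :
    IsRecurrenceSolution α β (orthPoly α β) where
  degree_le k := (degree_orthPoly hβ k).le
  recurrence k := by rw [orthPoly, C_mul_C_inv_mul (hβ _)]

theorem degree_assocPoly_le (α β : ℕ → ℝ) :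
    ∀ k : ℕ, (assocPoly α β k).degree ≤ (k : WithBot ℕ)
  | 0 => by simp [assocPoly]
  | 1 => by
    rw [assocPoly]
    exact degree_C_le.trans (by norm_num)
  | k + 2 => by
    have h1 : ((X - C (α (k + 1))) * assocPoly α β (k + 1)).degree ≤ ((k + 2 : ℕ) : WithBot ℕ) := by
      refine (degree_mul_le_of_le (degree_X_sub_C_le _) (degree_assocPoly_le α β (k + 1))).trans ?_
      norm_cast
      omega
    have h2 : (C (β k) * assocPoly α β k).degree ≤ ((k + 2 : ℕ) : WithBot ℕ) := by
      refine (degree_mul_le_of_le degree_C_le (degree_assocPoly_le α β k)).trans ?_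
      norm_cast
      omega
    rw [assocPoly]
    refine (degree_mul_le_of_le degree_C_le
      ((degree_sub_le _ _).trans (max_le h1 h2))).trans ?_
    simp

theorem isRecurrenceSolution_assocPoly {α β : ℕ → ℝ} (hβ : ∀ k, 0 < β k) :
    IsRecurrenceSolution α β (assocPoly α β) where
  degree_le := degree_assocPoly_le α β
  recurrence k := by rw [assocPoly, C_mul_C_inv_mul (hβ _)]

theorem polynomial_eq_of_eval_ne_zero {p q : ℝ[X]} (h : ∀ z : ℝ, z ≠ 0 → p.eval z = q.eval z) :
    p = q :=
  eq_of_infinite_eval_eq p q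
    ((Set.finite_singleton (0 : ℝ)).infinite_compl.mono fun z hz => h z hz)

theorem IsRecurrenceSolution.scaledPoly_recurrence {α β : ℕ → ℝ} {P : ℕ → ℝ[X]}
    (hP : IsRecurrenceSolution α β P) (k : ℕ) :
    C (2 * β (k + 1)) * scaledPoly (P (k + 2)) (k + 2) =
      (1 + X ^ 2 - C (2 * α (k + 1)) * X) * scaledPoly (P (k + 1)) (k + 1)
        - C (2 * β k) * X ^ 2 * scaledPoly (P k) k := by
  refine polynomial_eq_of_eval_ne_zero fun z hz => ?_
  have h := congrArg (eval ((z + z⁻¹) / 2)) (hP.recurrence k)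
  have hS : ∀ n, eval z (scaledPoly (P n) n) = z ^ n * eval ((z + z⁻¹) / 2) (P n) := fun n => by
    simpa only [coe_aeval_eq_eval] using aeval_scaledPoly (hP.degree_le n) hz
  simp only [eval_mul, eval_sub, eval_add, eval_C, eval_X, eval_pow, eval_one, hS] at h ⊢
  have hx : 1 + z ^ 2 = 2 * z * ((z + z⁻¹) / 2) := by field_simp; ring
  rw [hx]
  linear_combination 2 * z ^ (k + 2) * h

theorem freePolySequence_apply (i : ℕ) :
    freePolySequence i = orthPoly (fun _ => 0) (fun _ => 1 / 2) i := rfl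

/-- The rescaled Chebyshev polynomial is the geometric sum `1 + X² + ⋯ + X^(2i)`. -/
theorem one_sub_sq_mul_scaledPoly_free (i : ℕ) :
    (1 - X ^ 2) * scaledPoly (freePolySequence i) i = 1 - X ^ (2 * i + 2) := by
  have hP : IsRecurrenceSolution (fun _ => 0) (fun _ => 1 / 2)
      (orthPoly (fun _ => 0) (fun _ => 1 / 2)) :=
    isRecurrenceSolution_orthPoly fun _ => by norm_num
  rw [freePolySequence_apply]
  induction i using Nat.twoStepInduction with
  | zero =>
    simp [scaledPoly, orthPoly]
  | one =>
    refine polynomial_eq_of_eval_ne_zero fun z _ => ?_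
    simp [scaledPoly, orthPoly, Finset.sum_range_succ, coeff_X]
    ring
  | more k ih1 ih2 =>
    have h := hP.scaledPoly_recurrence k
    norm_num at h
    rw [h]
    linear_combination (1 + X ^ 2) * ih2 - X ^ 2 * ih1

theorem one_sub_sq_mul_scaledPoly {P : ℕ → ℝ[X]} {k : ℕ}
    (hP : (P k).degree ≤ (k : WithBot ℕ)) :
    (1 - X ^ 2) * scaledPoly (P k) k = ∑ i ∈ Finset.range (k + 1),
      C (connectionMatrix P freePolySequence i k) * (X ^ (k - i) - X ^ (k + i + 2)) := by
  refine polynomial_eq_of_eval_ne_zero fun z hz => ?_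
  have hS : ∀ (p : ℝ[X]) (n : ℕ), p.degree ≤ (n : WithBot ℕ) →
      eval z (scaledPoly p n) = z ^ n * eval ((z + z⁻¹) / 2) p := fun p n h => by
    simpa only [coe_aeval_eq_eval] using aeval_scaledPoly h hz
  have hU : ∀ i, (1 - z ^ 2) * (z ^ i * eval ((z + z⁻¹) / 2) (freePolySequence i)) =
      1 - z ^ (2 * i + 2) := fun i => by
    have h := congrArg (eval z) (one_sub_sq_mul_scaledPoly_free i)
    rw [eval_mul, hS _ _ (freePolySequence.degree_eq i).le] at h
    simpa using h
  rw [eval_mul, hS _ _ hP, eval_finsetSum]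
  conv_lhs => rw [connectionMatrix_expansion freePolySequence hP, eval_finsetSum, Finset.mul_sum,
    Finset.mul_sum]
  refine Finset.sum_congr rfl fun i hi => ?_
  obtain ⟨m, rfl⟩ := Nat.exists_eq_add_of_le (Nat.lt_succ_iff.1 (Finset.mem_range.1 hi))
  simp only [eval_smul, smul_eq_mul, eval_mul, eval_C, eval_sub, eval_pow, eval_X, eval_one,
    Nat.add_sub_cancel_left]
  linear_combination connectionMatrix P freePolySequence i (i + m) * z ^ m * hU i

/-- The reflected terms `X^(k+i'+2)`, with `k = i + j`, have degree above `j`, so only the term with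
`k - i' = j` contributes. -/
theorem coeff_one_sub_sq_mul_scaledPoly {P : ℕ → ℝ[X]} {i j : ℕ}
    (hP : (P (i + j)).degree ≤ ((i + j : ℕ) : WithBot ℕ)) :
    ((1 - X ^ 2) * scaledPoly (P (i + j)) (i + j)).coeff j =
      connectionMatrix P freePolySequence i (i + j) := by
  rw [one_sub_sq_mul_scaledPoly hP, finsetSum_coeff, Finset.sum_eq_single i]
  · rw [coeff_C_mul, coeff_sub, coeff_X_pow, coeff_X_pow, if_pos (by omega), if_neg (by omega)]
    ring
  · intro b hb hbi
    have := Finset.mem_range.1 hb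
    rw [coeff_C_mul, coeff_sub, coeff_X_pow, coeff_X_pow, if_neg (by omega), if_neg (by omega)]
    ring
  · intro h
    exact absurd (Finset.mem_range.2 (by omega)) h

/-! ### Perturbed geometric recurrences: coefficient bounds and limits. -/

/-- The coefficients of `p` are bounded by `M / r ^ j`. -/
def CoeffBound (r M : ℝ) (p : ℝ[X]) : Prop := ∀ j, |p.coeff j| * r ^ j ≤ M

theorem CoeffBound.mono {r M N : ℝ} {p : ℝ[X]} (hp : CoeffBound r M p) (h : M ≤ N) :
    CoeffBound r N p := fun j => (hp j).trans h

theorem CoeffBound.add {r M N : ℝ} (hr : 0 ≤ r) {p q : ℝ[X]} (hp : CoeffBound r M p)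
    (hq : CoeffBound r N q) : CoeffBound r (M + N) (p + q) := fun j => by
  have h := mul_le_mul_of_nonneg_right (abs_add_le (p.coeff j) (q.coeff j)) (pow_nonneg hr j)
  rw [coeff_add]
  linarith [hp j, hq j]

theorem CoeffBound.C_mul {r M : ℝ} (a : ℝ) {p : ℝ[X]} (hp : CoeffBound r M p) :
    CoeffBound r (|a| * M) (C a * p) := fun j => by
  rw [coeff_C_mul, abs_mul, mul_assoc]
  exact mul_le_mul_of_nonneg_left (hp j) (abs_nonneg a)

theorem CoeffBound.nonneg {r M : ℝ} {p : ℝ[X]} (hp : CoeffBound r M p) : 0 ≤ M := by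
  have h := hp 0
  rw [pow_zero, mul_one] at h
  exact (abs_nonneg _).trans h

theorem CoeffBound.X_mul {r M : ℝ} (hr : 0 ≤ r) {p : ℝ[X]} (hp : CoeffBound r M p) :
    CoeffBound r (r * M) (X * p) := fun j => by
  cases j with
  | zero => simpa using mul_nonneg hr hp.nonneg
  | succ j =>
    rw [coeff_X_mul, pow_succ]
    nlinarith [mul_le_mul_of_nonneg_left (hp j) hr]

theorem exists_coeffBound (r : ℝ) (p : ℝ[X]) : ∃ M, CoeffBound r M p := by
  obtain ⟨M, hM⟩ := (p.support.image fun j => |p.coeff j| * r ^ j).bddAbove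
  refine ⟨max M 0, fun j => ?_⟩
  by_cases hj : p.coeff j = 0
  · simp [hj]
  · exact (hM (Finset.mem_coe.2 (Finset.mem_image_of_mem _ (mem_support_iff.2 hj)))).trans
      (le_max_left _ _)

/-- A summable perturbation of the recurrence `Q (k + 2) = (1 + X ^ 2) * Q (k + 1) - X ^ 2 * Q k`,
which `1 + X ^ 2 + ⋯ + X ^ (2 * k)` satisfies. -/
def IsPerturbedGeometric (a b : ℕ → ℝ) (Q : ℕ → ℝ[X]) : Prop :=
  ∀ k, (Q (k + 2) - X ^ 2 * Q (k + 1)) - (Q (k + 1) - X ^ 2 * Q k) =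
    C (a k) * (X * Q (k + 1)) + C (b k) * (X * (X * Q k))

namespace IsPerturbedGeometric

variable {a b : ℕ → ℝ} {Q : ℕ → ℝ[X]}

/-- Discrete Gronwall: `N k` bounds `Q (k + 1) - X ^ 2 * Q k` and grows by the factor `1 + ε k`, so
summability of `ε` keeps it bounded. -/
theorem exists_coeffBound (hQ : IsPerturbedGeometric a b Q)
    (hab : Summable fun k => |a k| + |b k|) {r : ℝ} (hr0 : 0 < r) (hr1 : r < 1) :
    ∃ M, ∀ k, CoeffBound r M (Q k) := by
  obtain ⟨M1, hM1⟩ := _root_.exists_coeffBound r (Q 0)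
  obtain ⟨M2, hM2⟩ := _root_.exists_coeffBound r (Q 1 - X ^ 2 * Q 0)
  have hM0 : 0 ≤ M1 + M2 := add_nonneg hM1.nonneg hM2.nonneg
  have hs : 0 < 1 - r ^ 2 := by nlinarith
  set ε : ℕ → ℝ := fun i => (|a i| + |b i|) / (1 - r ^ 2) with hε
  have hε0 : ∀ i, 0 ≤ ε i := fun i => by positivity
  set N : ℕ → ℝ := fun k => (M1 + M2) * ∏ i ∈ Finset.range k, (1 + ε i) with hN
  have hNpos : ∀ k, 0 ≤ N k := fun k =>
    mul_nonneg hM0 (Finset.prod_nonneg fun i _ => by linarith [hε0 i])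
  have hNsucc : ∀ k, N (k + 1) = N k + (|a k| + |b k|) * (N k / (1 - r ^ 2)) := fun k => by
    simp only [hN, hε, Finset.prod_range_succ]
    ring
  -- Inverting `1 - X ^ 2` costs a factor `1 / (1 - r²)`, because `M + r² · M / (1 - r²) = M / (1 -
  -- r²)`.
  have hgeom : ∀ {M p q}, CoeffBound r M (p - X ^ 2 * q) → CoeffBound r (M / (1 - r ^ 2)) q →
      CoeffBound r (M / (1 - r ^ 2)) p := fun {M p q} hp hq => by
    have h := hp.add hr0.le ((hq.X_mul hr0.le).X_mul hr0.le)
    rw [show p - X ^ 2 * q + X * (X * q) = p by ring] at h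
    refine h.mono (le_of_eq ?_)
    field_simp
    ring
  have key : ∀ k, CoeffBound r (N k) (Q (k + 1) - X ^ 2 * Q k) ∧
      CoeffBound r (N k / (1 - r ^ 2)) (Q k) ∧ CoeffBound r (N k / (1 - r ^ 2)) (Q (k + 1)) := by
    intro k
    induction k with
    | zero =>
      have h0 : N 0 = M1 + M2 := by simp [hN]
      have h1 : CoeffBound r (N 0) (Q 1 - X ^ 2 * Q 0) := hM2.mono (by linarith [hM1.nonneg])
      have h2 : CoeffBound r (N 0 / (1 - r ^ 2)) (Q 0) := hM1.mono (by
        rw [le_div_iff₀ hs, h0]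
        nlinarith [hM1.nonneg, hM2.nonneg, sq_nonneg r])
      exact ⟨h1, h2, hgeom h1 h2⟩
    | succ k ih =>
      obtain ⟨h1, h2, h3⟩ := ih
      have hK : 0 ≤ N k / (1 - r ^ 2) := div_nonneg (hNpos k) hs.le
      have hle : N k ≤ N (k + 1) := by
        rw [hNsucc]
        have : 0 ≤ (|a k| + |b k|) * (N k / (1 - r ^ 2)) := by positivity
        linarith
      have h4 : CoeffBound r (N (k + 1)) (Q (k + 2) - X ^ 2 * Q (k + 1)) := by
        have h := h1.add hr0.le (((h3.X_mul hr0.le).C_mul (a k)).add hr0.le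
          (((h2.X_mul hr0.le).X_mul hr0.le).C_mul (b k)))
        rw [← hQ k, add_sub_cancel] at h
        refine h.mono ?_
        have e1 : r * (N k / (1 - r ^ 2)) ≤ N k / (1 - r ^ 2) := mul_le_of_le_one_left hK hr1.le
        have e2 : r * (r * (N k / (1 - r ^ 2))) ≤ N k / (1 - r ^ 2) :=
          (mul_le_of_le_one_left (mul_nonneg hr0.le hK) hr1.le).trans e1
        rw [hNsucc]
        nlinarith [mul_le_mul_of_nonneg_left e1 (abs_nonneg (a k)),
          mul_le_mul_of_nonneg_left e2 (abs_nonneg (b k))]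
      have h5 : CoeffBound r (N (k + 1) / (1 - r ^ 2)) (Q (k + 1)) :=
        h3.mono (div_le_div_of_nonneg_right hle hs.le)
      exact ⟨h4, h5, hgeom h4 h5⟩
  have hεs : Summable ε := hab.div_const _
  refine ⟨(M1 + M2) * Real.exp (∑' i, ε i) / (1 - r ^ 2), fun k => (key k).2.1.mono ?_⟩
  refine div_le_div_of_nonneg_right (mul_le_mul_of_nonneg_left ?_ hM0) hs.le
  calc ∏ i ∈ Finset.range k, (1 + ε i) ≤ ∏ i ∈ Finset.range k, Real.exp (ε i) :=
        Finset.prod_le_prod (fun i _ => by linarith [hε0 i])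
          fun i _ => by linarith [Real.add_one_le_exp (ε i)]
    _ = Real.exp (∑ i ∈ Finset.range k, ε i) := (Real.exp_sum _ _).symm
    _ ≤ _ := Real.exp_le_exp.2 (hεs.sum_le_tsum _ fun i _ => hε0 i)

theorem exists_tendsto_coeff (hQ : IsPerturbedGeometric a b Q)
    (hab : Summable fun k => |a k| + |b k|) (j : ℕ) :
    ∃ l, Tendsto (fun k => (Q k).coeff j) atTop (𝓝 l) := by
  -- Any fixed radius in `(0, 1)` would do, as `j` is fixed.
  obtain ⟨M, hM⟩ := hQ.exists_coeffBound hab (r := 1 / 2) (by norm_num) (by norm_num)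
  have hr : (0 : ℝ) ≤ 1 / 2 := by norm_num
  have hM0 : 0 ≤ M := (hM 0).nonneg
  have hD : ∀ j, ∃ l, Tendsto (fun k => (Q (k + 1) - X ^ 2 * Q k).coeff j) atTop (𝓝 l) := by
    intro j
    refine cauchySeq_tendsto_of_complete (cauchySeq_of_dist_le_of_summable
      (fun k => (|a k| + |b k|) * (M * 2 ^ j)) (fun k => ?_) (hab.mul_right _))
    have h := ((((hM (k + 1)).X_mul hr).C_mul (a k)).add hr
          ((((hM k).X_mul hr).X_mul hr).C_mul (b k))) j
    rw [← hQ k, coeff_sub] at h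
    rw [dist_comm, Real.dist_eq, ← mul_assoc, ← div_le_iff₀ (by positivity)]
    rw [one_div, inv_pow, ← div_eq_mul_inv] at h
    refine h.trans ?_
    nlinarith [mul_nonneg (abs_nonneg (a k)) hM0, mul_nonneg (abs_nonneg (b k)) hM0]
  induction j using Nat.strong_induction_on with
  | _ j ih =>
    obtain ⟨l, hl⟩ := hD j
    -- Coefficient `j` of `X ^ 2 * Q k` is coefficient `j - 2` of `Q k`, or `0` if `j < 2`; hence
    -- the strong induction.
    have hsplit : ∀ k, (Q (k + 1)).coeff j =
        (Q (k + 1) - X ^ 2 * Q k).coeff j + (X ^ 2 * Q k).coeff j := fun k => by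
      rw [coeff_sub, sub_add_cancel]
    have hX : ∃ l', Tendsto (fun k => (X ^ 2 * Q k).coeff j) atTop (𝓝 l') := by
      by_cases hj : 2 ≤ j
      · obtain ⟨l', hl'⟩ := ih (j - 2) (by omega)
        refine ⟨l', hl'.congr fun k => ?_⟩
        rw [coeff_X_pow_mul', if_pos hj]
      · refine ⟨0, tendsto_const_nhds.congr fun k => ?_⟩
        rw [coeff_X_pow_mul', if_neg hj]
    obtain ⟨l', hl'⟩ := hX
    exact ⟨l + l', (tendsto_add_atTop_iff_nat 1).1 ((hl.add hl').congr fun k => (hsplit k).symm)⟩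

end IsPerturbedGeometric

/-! ### Power series in the unit disc. -/

theorem summable_norm_of_coeffBound {t : ℕ → ℝ} {r M : ℝ} (ht : ∀ j, |t j| * r ^ j ≤ M)
    {ρ : ℝ} (hρ : 0 ≤ ρ) (hρr : ρ < r) : Summable fun j => |t j| * ρ ^ j := by
  have hr : 0 < r := hρ.trans_lt hρr
  refine Summable.of_nonneg_of_le (fun j => by positivity) (fun j => ?_)
    ((summable_geometric_of_lt_one (div_nonneg hρ hr.le) ((div_lt_one hr).2 hρr)).mul_left M)
  calc |t j| * ρ ^ j = |t j| * r ^ j * (ρ / r) ^ j := by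
        rw [div_pow]
        field_simp
    _ ≤ M * (ρ / r) ^ j := mul_le_mul_of_nonneg_right (ht j) (by positivity)

theorem analyticOnNhd_tsum_of_coeffBound {t : ℕ → ℝ}
    (ht : ∀ r : ℝ, 0 < r → r < 1 → ∃ M, ∀ j, |t j| * r ^ j ≤ M) :
    AnalyticOnNhd ℂ (fun z : ℂ => ∑' j, (t j : ℂ) * z ^ j) (Metric.ball 0 1) := by
  refine DifferentiableOn.analyticOnNhd (fun z hz => ?_) Metric.isOpen_ball
  obtain ⟨ρ, hρ1, hρ2⟩ := exists_between (mem_ball_zero_iff.1 hz)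
  obtain ⟨r, hr1, hr2⟩ := exists_between hρ2
  have hρ0 : 0 ≤ ρ := (norm_nonneg z).trans hρ1.le
  obtain ⟨M, hM⟩ := ht r (hρ0.trans_lt hr1) hr2
  have h : DifferentiableOn ℂ (fun z : ℂ => ∑' j, (t j : ℂ) * z ^ j) (Metric.ball 0 ρ) :=
    Complex.differentiableOn_tsum_of_summable_norm (summable_norm_of_coeffBound hM hρ0 hr1)
      (fun j => ((differentiable_id.pow j).const_mul _).differentiableOn) Metric.isOpen_ball
      fun j w hw => by
        rw [norm_mul, norm_pow, Complex.norm_real, Real.norm_eq_abs]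
        have := (mem_ball_zero_iff.1 hw).le
        gcongr
  exact (h.differentiableAt (Metric.isOpen_ball.mem_nhds
    (mem_ball_zero_iff.2 hρ1))).differentiableWithinAt

theorem aeval_eq_tsum_coeff (p : ℝ[X]) (z : ℂ) :
    aeval z p = ∑' j, (p.coeff j : ℂ) * z ^ j := by
  rw [aeval_eq_sum_range, tsum_eq_sum (s := Finset.range (p.natDegree + 1)) fun j hj => ?_]
  · exact Finset.sum_congr rfl fun j _ => by rw [Algebra.smul_def]; rfl
  · rw [coeff_eq_zero_of_natDegree_lt (by simpa using hj), Complex.ofReal_zero, zero_mul]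

/-! ### Toeplitz limits for Jacobi recurrences. -/

/-- The ratio of the leading coefficients of the Chebyshev polynomial `U_k` and of `P_k`. -/
noncomputable def offDiagProd (β : ℕ → ℝ) (k : ℕ) : ℝ := ∏ i ∈ Finset.range k, 2 * β i

theorem offDiagProd_succ (β : ℕ → ℝ) (k : ℕ) :
    offDiagProd β (k + 1) = offDiagProd β k * (2 * β k) := Finset.prod_range_succ _ _

theorem offDiagProd_pos {β : ℕ → ℝ} (hβ : ∀ k, 0 < β k) (k : ℕ) : 0 < offDiagProd β k :=
  Finset.prod_pos fun i _ => mul_pos two_pos (hβ i)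

/-- The right side is shaped for `CoeffBound.add`, `CoeffBound.C_mul` and `CoeffBound.X_mul`. -/
theorem one_sub_sq_mul_scaledPoly_eq {β : ℕ → ℝ} (p : ℝ[X]) (hβ : ∀ k, 0 < β k) (k : ℕ) :
    (1 - X ^ 2) * scaledPoly p k = C (offDiagProd β k)⁻¹ *
      (C (offDiagProd β k) * scaledPoly p k +
        C (-1) * (X * (X * (C (offDiagProd β k) * scaledPoly p k)))) := by
  have h := C_mul_C_inv_mul (offDiagProd_pos hβ k) ((1 - X ^ 2) * scaledPoly p k)
  conv_lhs => rw [← h]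
  rw [C_neg, C_1]
  ring

namespace IsToeplitzPlusTraceClass

variable {α β : ℕ → ℝ}

theorem summable_abs_diag (hJ : IsToeplitzPlusTraceClass α β) : Summable fun k => |α k| :=
  Summable.of_nonneg_of_le (fun _ => abs_nonneg _)
    (fun k => le_add_of_nonneg_left (abs_nonneg (β k - 1 / 2))) hJ

theorem summable_abs_offDiag (hJ : IsToeplitzPlusTraceClass α β) : Summable fun k => |β k - 1 / 2| :=
  Summable.of_nonneg_of_le (fun _ => abs_nonneg _)
    (fun k => le_add_of_nonneg_right (abs_nonneg (α k))) hJ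

theorem summable_perturbation (hJ : IsToeplitzPlusTraceClass α β) :
    Summable fun k => |-(2 * α (k + 1))| + |1 - (2 * β k) ^ 2| := by
  obtain ⟨M, hM⟩ := hJ.boundedCoeffs
  refine Summable.add ?_ ?_
  · refine (((summable_nat_add_iff 1).2 hJ.summable_abs_diag).mul_left 2).congr fun k => ?_
    rw [abs_neg, abs_mul, abs_two]
  · refine Summable.of_nonneg_of_le (fun _ => abs_nonneg _) (fun k => ?_)
      (hJ.summable_abs_offDiag.mul_left (2 * (1 + 2 * M)))
    rw [show 1 - (2 * β k) ^ 2 = -(2 * (1 + 2 * β k) * (β k - 1 / 2)) by ring, abs_neg, abs_mul,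
      abs_mul, abs_two]
    have h := abs_add_le 1 (2 * β k)
    rw [abs_one, abs_mul, abs_two] at h
    have := (hM k).2
    gcongr
    linarith

/-- The limit is an exponential of a convergent sum of logarithms, hence positive; so dividing by
`offDiagProd` preserves limits and bounds. -/
theorem exists_tendsto_offDiagProd (hJ : IsToeplitzPlusTraceClass α β)
    (hβ : ∀ k, 0 < β k) :
    ∃ l, 0 < l ∧ Tendsto (offDiagProd β) atTop (𝓝 l) := by
  have h1 : Summable fun k => 2 * β k - 1 :=
    (hJ.summable_abs_offDiag.of_abs.mul_left 2).congr fun k => by ring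
  have h2 := Real.summable_log_one_add_of_summable h1
  refine ⟨_, Real.exp_pos (∑' k, Real.log (1 + (2 * β k - 1))),
    ((Real.continuous_exp.tendsto _).comp h2.hasSum.tendsto_sum_nat).congr fun k => ?_⟩
  rw [Function.comp_apply, Real.exp_sum]
  refine Finset.prod_congr rfl fun i _ => ?_
  rw [add_sub_cancel, Real.exp_log (mul_pos two_pos (hβ i))]

end IsToeplitzPlusTraceClass

namespace IsRecurrenceSolution

variable {α β : ℕ → ℝ} {P : ℕ → ℝ[X]}

/-- Multiplying by `offDiagProd` makes the coefficient of `Q (k + 2)` equal to `1` and gathers the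
off-diagonals into `(2 * β k) ^ 2`. -/
theorem isPerturbedGeometric (hP : IsRecurrenceSolution α β P) :
    IsPerturbedGeometric (fun k => -(2 * α (k + 1))) (fun k => 1 - (2 * β k) ^ 2)
      (fun k => C (offDiagProd β k) * scaledPoly (P k) k) := by
  intro k
  have h := hP.scaledPoly_recurrence k
  simp only [offDiagProd_succ, C_mul, C_neg, C_sub, C_pow, C_1] at h ⊢
  linear_combination C (offDiagProd β k) * (C 2 * C (β k)) * h

theorem exists_coeffBound (hP : IsRecurrenceSolution α β P)
    (hβ : ∀ k, 0 < β k) (hJ : IsToeplitzPlusTraceClass α β) {r : ℝ} (hr0 : 0 < r) (hr1 : r < 1) :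
    ∃ M, ∀ k, CoeffBound r M ((1 - X ^ 2) * scaledPoly (P k) k) := by
  obtain ⟨M, hM⟩ := hP.isPerturbedGeometric.exists_coeffBound hJ.summable_perturbation hr0 hr1
  obtain ⟨l, hl, hA⟩ := hJ.exists_tendsto_offDiagProd hβ
  obtain ⟨N, hN⟩ := (hA.inv₀ hl.ne').abs.bddAbove_range
  refine ⟨N * (M + |-1| * (r * (r * M))), fun k => ?_⟩
  rw [one_sub_sq_mul_scaledPoly_eq (P k) hβ k]
  have h := (hM k).add hr0.le ((((hM k).X_mul hr0.le).X_mul hr0.le).C_mul (-1))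
  exact (h.C_mul _).mono (mul_le_mul_of_nonneg_right (hN ⟨k, rfl⟩) h.nonneg)

theorem exists_tendsto_coeff (hP : IsRecurrenceSolution α β P)
    (hβ : ∀ k, 0 < β k) (hJ : IsToeplitzPlusTraceClass α β) (j : ℕ) :
    ∃ l, Tendsto (fun k => ((1 - X ^ 2) * scaledPoly (P k) k).coeff j) atTop (𝓝 l) := by
  obtain ⟨l, hl, hA⟩ := hJ.exists_tendsto_offDiagProd hβ
  have hQ := hP.isPerturbedGeometric.exists_tendsto_coeff hJ.summable_perturbation
  obtain ⟨l₁, h₁⟩ := hQ j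
  have h₂ : ∃ l', Tendsto (fun k => (X * (X * (C (offDiagProd β k) * scaledPoly (P k) k))).coeff j)
      atTop (𝓝 l') := by
    match j with
    | 0 => exact ⟨0, by simp⟩
    | 1 => exact ⟨0, by simp [coeff_X_mul]⟩
    | j + 2 =>
      obtain ⟨l', h'⟩ := hQ j
      exact ⟨l', h'.congr fun k => by rw [coeff_X_mul, coeff_X_mul]⟩
  obtain ⟨l₂, h₂⟩ := h₂
  refine ⟨l⁻¹ * (l₁ + -1 * l₂), ((hA.inv₀ hl.ne').mul (h₁.add (h₂.const_mul _))).congr fun k => ?_⟩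
  rw [one_sub_sq_mul_scaledPoly_eq (P k) hβ k]
  simp only [coeff_C_mul, coeff_add]

theorem tendsto_connectionMatrix (hP : IsRecurrenceSolution α β P)
    (hβ : ∀ k, 0 < β k) (hJ : IsToeplitzPlusTraceClass α β) (j : ℕ) :
    Tendsto (fun i => connectionMatrix P freePolySequence i (i + j)) atTop
      (𝓝 (toeplitzCoeff (connectionMatrix P freePolySequence) j)) := by
  obtain ⟨l, hl⟩ := hP.exists_tendsto_coeff hβ hJ j
  exact tendsto_nhds_limUnder ⟨l, ((tendsto_add_atTop_iff_nat j).2 hl).congr fun i =>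
    coeff_one_sub_sq_mul_scaledPoly (hP.degree_le _)⟩

theorem tendsto_coeff (hP : IsRecurrenceSolution α β P)
    (hβ : ∀ k, 0 < β k) (hJ : IsToeplitzPlusTraceClass α β) (j : ℕ) :
    Tendsto (fun k => ((1 - X ^ 2) * scaledPoly (P k) k).coeff j) atTop
      (𝓝 (toeplitzCoeff (connectionMatrix P freePolySequence) j)) :=
  (tendsto_add_atTop_iff_nat j).1 ((hP.tendsto_connectionMatrix hβ hJ j).congr fun _ =>
    (coeff_one_sub_sq_mul_scaledPoly (hP.degree_le _)).symm)

theorem toeplitzCoeff_bound (hP : IsRecurrenceSolution α β P)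
    (hβ : ∀ k, 0 < β k) (hJ : IsToeplitzPlusTraceClass α β) {r : ℝ} (hr0 : 0 < r) (hr1 : r < 1) :
    ∃ M, ∀ j, |toeplitzCoeff (connectionMatrix P freePolySequence) j| * r ^ j ≤ M := by
  obtain ⟨M, hM⟩ := hP.exists_coeffBound hβ hJ hr0 hr1
  exact ⟨M, fun j => le_of_tendsto ((hP.tendsto_coeff hβ hJ j).abs.mul_const _)
    (Eventually.of_forall fun k => hM k j)⟩

theorem summable_toeplitzCoeff (hP : IsRecurrenceSolution α β P)
    (hβ : ∀ k, 0 < β k) (hJ : IsToeplitzPlusTraceClass α β) {z : ℂ} (hz : z ∈ Metric.ball (0 : ℂ) 1) :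
    Summable fun j => (toeplitzCoeff (connectionMatrix P freePolySequence) j : ℂ) * z ^ j := by
  obtain ⟨r, hr1, hr2⟩ := exists_between (mem_ball_zero_iff.1 hz)
  obtain ⟨M, hM⟩ := hP.toeplitzCoeff_bound hβ hJ ((norm_nonneg z).trans_lt hr1) hr2
  refine Summable.of_norm ((summable_norm_of_coeffBound hM (norm_nonneg z) hr1).congr fun j => ?_)
  rw [norm_mul, norm_pow, Complex.norm_real, Real.norm_eq_abs]

theorem analyticOnNhd_toeplitzSymbol (hP : IsRecurrenceSolution α β P)
    (hβ : ∀ k, 0 < β k) (hJ : IsToeplitzPlusTraceClass α β) :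
    AnalyticOnNhd ℂ (toeplitzSymbol (connectionMatrix P freePolySequence)) (Metric.ball 0 1) :=
  analyticOnNhd_tsum_of_coeffBound fun _ => hP.toeplitzCoeff_bound hβ hJ

/-- Dominated convergence: for `‖z‖ < r < 1` the uniform coefficient bound gives the geometric
majorant `M * (‖z‖ / r) ^ j`. -/
theorem tendsto_toeplitzSymbol (hP : IsRecurrenceSolution α β P) (hβ : ∀ k, 0 < β k)
    (hJ : IsToeplitzPlusTraceClass α β) {z : ℂ} (hz : z ∈ Metric.ball (0 : ℂ) 1) (hz0 : z ≠ 0) :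
    Tendsto (fun k => (1 - z ^ 2) * (z ^ k * aeval (joukowski z) (P k))) atTop
      (𝓝 (toeplitzSymbol (connectionMatrix P freePolySequence) z)) := by
  obtain ⟨r, hr1, hr2⟩ := exists_between (mem_ball_zero_iff.1 hz)
  have hr0 : 0 < r := (norm_nonneg z).trans_lt hr1
  obtain ⟨M, hM⟩ := hP.exists_coeffBound hβ hJ hr0 hr2
  have hval : ∀ k, (1 - z ^ 2) * (z ^ k * aeval (joukowski z) (P k)) =
      ∑' j, (((1 - X ^ 2) * scaledPoly (P k) k).coeff j : ℂ) * z ^ j := fun k => by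
    rw [joukowski, ← aeval_scaledPoly (hP.degree_le k) hz0, ← aeval_eq_tsum_coeff]
    simp
  simp only [hval]
  refine tendsto_tsum_of_dominated_convergence (bound := fun j => M * (‖z‖ / r) ^ j)
    ((summable_geometric_of_lt_one (by positivity) ((div_lt_one hr0).2 hr1)).mul_left M)
    (fun j => ((Complex.continuous_ofReal.tendsto _).comp (hP.tendsto_coeff hβ hJ j)).mul_const _)
    (Eventually.of_forall fun k j => ?_)
  rw [norm_mul, norm_pow, Complex.norm_real, Real.norm_eq_abs]
  calc |((1 - X ^ 2) * scaledPoly (P k) k).coeff j| * ‖z‖ ^ j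
      = |((1 - X ^ 2) * scaledPoly (P k) k).coeff j| * r ^ j * (‖z‖ / r) ^ j := by
        rw [div_pow]
        field_simp
    _ ≤ M * (‖z‖ / r) ^ j := mul_le_mul_of_nonneg_right (hM k j) (by positivity)

end IsRecurrenceSolution

/-! ### Decay of scalar solutions of the perturbed recurrence. -/

/-- The scalar analogue of `IsPerturbedGeometric`, at the point `z`. -/
def IsPerturbedGeometricAt (a b : ℕ → ℝ) (z : ℂ) (q : ℕ → ℂ) : Prop :=
  ∀ k, (q (k + 2) - z ^ 2 * q (k + 1)) - (q (k + 1) - z ^ 2 * q k) =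
    a k * (z * q (k + 1)) + b k * (z * (z * q k))

theorem tendsto_tsum_tail_zero (f : ℕ → ℝ) :
    Tendsto (fun n => ∑' m, f (n + m)) atTop (𝓝 0) := by
  simpa only [add_comm] using tendsto_sum_nat_add f

namespace IsPerturbedGeometricAt

variable {a b : ℕ → ℝ} {z : ℂ} {q : ℕ → ℂ}

/-- As `q → 0`, the difference `q (m + 1) - z ^ 2 * q m` also tends to `0`, so its value at `N` is
minus the sum of its later increments. -/
theorem norm_ratio_sub_le (hq : IsPerturbedGeometricAt a b z q)
    (hab : Summable fun k => |a k| + |b k|) (hz : ‖z‖ ≤ 1) (hlim : Tendsto q atTop (𝓝 0))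
    {N : ℕ} {s : ℝ} (hs : ∀ m, N ≤ m → ‖q m‖ ≤ s) :
    ‖q (N + 1) - z ^ 2 * q N‖ ≤ s * ∑' m, (|a (N + m)| + |b (N + m)|) := by
  have hs0 : 0 ≤ s := (norm_nonneg _).trans (hs N le_rfl)
  have hsum : Summable fun m => |a (N + m)| + |b (N + m)| := by
    simpa only [add_comm] using (summable_nat_add_iff N).2 hab
  have hlim' : Tendsto (fun m => q (N + m + 1) - z ^ 2 * q (N + m)) atTop (𝓝 0) := by
    have h : Tendsto (fun m => q (m + 1) - z ^ 2 * q m) atTop (𝓝 0) := by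
      simpa using ((tendsto_add_atTop_iff_nat 1).2 hlim).sub (hlim.const_mul (z ^ 2))
    simpa only [add_comm] using (tendsto_add_atTop_iff_nat N).2 h
  have key := dist_le_tsum_of_dist_le_of_tendsto₀ (fun m => s * (|a (N + m)| + |b (N + m)|))
    (fun m => ?_) (hsum.mul_left s) hlim'
  · rwa [dist_zero_right, tsum_mul_left] at key
  · have hzm : ∀ {y : ℂ}, ‖y‖ ≤ s → ‖z * y‖ ≤ s := fun {y} hy => by
      rw [norm_mul]
      exact (mul_le_of_le_one_left (norm_nonneg y) hz).trans hy
    have h1 := hzm (hs (N + m + 1) (by omega))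
    have h2 := hzm (hzm (hs (N + m) (by omega)))
    rw [dist_comm, dist_eq_norm, Nat.succ_eq_add_one, ← add_assoc, hq (N + m)]
    refine (norm_add_le _ _).trans ?_
    rw [norm_mul, norm_mul (b _ : ℂ), Complex.norm_real, Complex.norm_real, Real.norm_eq_abs,
      Real.norm_eq_abs]
    nlinarith [mul_le_mul_of_nonneg_left h1 (abs_nonneg (a (N + m))),
      mul_le_mul_of_nonneg_left h2 (abs_nonneg (b (N + m)))]

theorem exists_norm_le_pow (hq : IsPerturbedGeometricAt a b z q)
    (hab : Summable fun k => |a k| + |b k|) (hz0 : z ≠ 0) (hz1 : ‖z‖ < 1)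
    (hlim : Tendsto q atTop (𝓝 0)) : ∃ M, ∀ k, ‖q k‖ ≤ M * ‖z‖ ^ k := by
  have hr : 0 < ‖z‖ := norm_pos_iff.2 hz0
  obtain ⟨s, hs⟩ := hlim.norm.bddAbove_range
  replace hs : ∀ k, ‖q k‖ ≤ s := fun k => hs ⟨k, rfl⟩
  have hs0 : 0 ≤ s := (norm_nonneg _).trans (hs 0)
  -- With tails at most `‖z‖ - ‖z‖²`, a bound `S` on all later terms yields the bound `S (‖z‖ -
  -- ‖z‖²) + ‖z‖² S = ‖z‖ S` one index further on.
  have hgap : 0 < ‖z‖ - ‖z‖ ^ 2 := by nlinarith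
  obtain ⟨N, hN⟩ := eventually_atTop.1
    ((tendsto_tsum_tail_zero fun k => |a k| + |b k|).eventually_le_const hgap)
  have key : ∀ k m, N + k ≤ m → ‖q m‖ ≤ s * ‖z‖ ^ k := by
    intro k
    induction k with
    | zero => exact fun m _ => by simpa using hs m
    | succ k ih =>
      intro m hm
      obtain ⟨m, rfl⟩ : ∃ n, m = n + 1 := ⟨m - 1, by omega⟩
      have hm' : N + k ≤ m := by omega
      have h1 := hq.norm_ratio_sub_le hab hz1.le hlim (N := m) (s := s * ‖z‖ ^ k)
        fun n hn => ih n (hm'.trans hn)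
      have h2 := hN m (by omega)
      have h3 : ‖q (m + 1)‖ ≤ ‖q (m + 1) - z ^ 2 * q m‖ + ‖z ^ 2 * q m‖ := by
        have h := norm_add_le (q (m + 1) - z ^ 2 * q m) (z ^ 2 * q m)
        rwa [sub_add_cancel] at h
      rw [norm_mul, norm_pow] at h3
      have h4 := mul_le_mul_of_nonneg_left (ih m hm') (sq_nonneg ‖z‖)
      have h5 := mul_le_mul_of_nonneg_left h2 (mul_nonneg hs0 (pow_nonneg hr.le k))
      rw [pow_succ]
      nlinarith
  refine ⟨s / ‖z‖ ^ N, fun k => ?_⟩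
  rw [div_mul_eq_mul_div, le_div_iff₀ (pow_pos hr N)]
  rcases le_total N k with h | h
  · obtain ⟨m, rfl⟩ := Nat.exists_eq_add_of_le h
    rw [pow_add]
    nlinarith [mul_le_mul_of_nonneg_right (key m (N + m) le_rfl) (pow_nonneg hr.le N)]
  · exact mul_le_mul (hs k) (pow_le_pow_of_le_one hr.le hz1.le h) (pow_nonneg hr.le _) hs0

/-- This reflects `λ(z) = λ(z⁻¹)`: the factor turns the weight `z^k` into `z^(-k)`. -/
theorem inv (hq : IsPerturbedGeometricAt a b z q) (hz : z ≠ 0) :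
    IsPerturbedGeometricAt a b z⁻¹ fun k => (z⁻¹) ^ (2 * k) * q k := by
  intro k
  have h := hq k
  simp only [mul_add, pow_add, inv_pow]
  field_simp
  linear_combination z ^ 4 * h

/-- On the circle the estimate applies at both `z` and `z⁻¹`, bounding `q (m + 1) - z ^ 2 * q m` and
`q (m + 1) - q m`; their difference is `(1 - z ^ 2) * q m`. -/
theorem eventually_eq_zero (hq : IsPerturbedGeometricAt a b z q)
    (hab : Summable fun k => |a k| + |b k|) (hz1 : ‖z‖ = 1) (hz2 : z ^ 2 ≠ 1)
    (hlim : Tendsto q atTop (𝓝 0)) : ∃ N, ∀ k, N ≤ k → q k = 0 := by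
  have hz0 : z ≠ 0 := norm_pos_iff.1 (by rw [hz1]; exact one_pos)
  have hzi : ‖z⁻¹‖ = 1 := by rw [norm_inv, hz1, inv_one]
  have hnorm : ∀ k, ‖(z⁻¹) ^ (2 * k) * q k‖ = ‖q k‖ := fun k => by
    rw [norm_mul, norm_pow, hzi, one_pow, one_mul]
  have hlim' : Tendsto (fun k => (z⁻¹) ^ (2 * k) * q k) atTop (𝓝 0) := by
    rw [tendsto_zero_iff_norm_tendsto_zero] at hlim ⊢
    simpa only [hnorm] using hlim
  obtain ⟨s, hs⟩ := hlim.norm.bddAbove_range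
  replace hs : ∀ k, ‖q k‖ ≤ s := fun k => hs ⟨k, rfl⟩
  have hd : 0 < ‖1 - z ^ 2‖ := norm_pos_iff.2 (sub_ne_zero.2 hz2.symm)
  -- Two tails of `‖1 - z²‖ / 4` each halve the bound on `q` beyond `N`. As `N` stays fixed, this
  -- iterates and forces `q m = 0` for `m ≥ N`.
  obtain ⟨N, hN⟩ := eventually_atTop.1
    ((tendsto_tsum_tail_zero fun k => |a k| + |b k|).eventually_le_const
      (show 0 < ‖1 - z ^ 2‖ / 4 by positivity))
  have key : ∀ n m, N ≤ m → ‖q m‖ ≤ s * (1 / 2) ^ n := by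
    intro n
    induction n with
    | zero => exact fun m _ => by simpa using hs m
    | succ n ih =>
      intro m hm
      have hsn : 0 ≤ s * (1 / 2) ^ n := (norm_nonneg _).trans (ih m hm)
      have h1 := hq.norm_ratio_sub_le hab hz1.le hlim (N := m) fun k hk => ih k (hm.trans hk)
      have h2 := (hq.inv hz0).norm_ratio_sub_le hab hzi.le hlim' (N := m)
        fun k hk => (hnorm k).le.trans (ih k (hm.trans hk))
      have h3 : (z⁻¹) ^ (2 * (m + 1)) * q (m + 1) - (z⁻¹) ^ 2 * ((z⁻¹) ^ (2 * m) * q m) =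
          (z⁻¹) ^ (2 * (m + 1)) * (q (m + 1) - q m) := by ring
      rw [h3, norm_mul, norm_pow, hzi, one_pow, one_mul] at h2
      have h4 : (1 - z ^ 2) * q m = (q (m + 1) - z ^ 2 * q m) - (q (m + 1) - q m) := by ring
      have h5 := norm_sub_le (q (m + 1) - z ^ 2 * q m) (q (m + 1) - q m)
      rw [← h4, norm_mul] at h5
      have h6 := mul_le_mul_of_nonneg_left (hN m hm) hsn
      have h7 : ‖1 - z ^ 2‖ * ‖q m‖ ≤ ‖1 - z ^ 2‖ * (s * (1 / 2) ^ (n + 1)) := by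
        rw [pow_succ (1 / 2 : ℝ) n]
        linarith
      exact le_of_mul_le_mul_left h7 hd
  have hpow : Tendsto (fun n : ℕ => s * (1 / 2 : ℝ) ^ n) atTop (𝓝 0) := by
    simpa using (tendsto_pow_atTop_nhds_zero_of_lt_one (r := (1 / 2 : ℝ)) (by norm_num)
      (by norm_num)).const_mul s
  exact ⟨N, fun m hm => norm_le_zero_iff.1 (ge_of_tendsto' hpow fun n => key n m hm)⟩

end IsPerturbedGeometricAt

/-! ### Complex solutions of the three-term recurrence. -/

/-- The complex solutions of the three-term recurrence at `x`, away from the first row. -/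
def IsFormalSolution (α β : ℕ → ℝ) (x : ℂ) (w : ℕ → ℂ) : Prop :=
  ∀ k, jacobiAction α β w (k + 1) = x * w (k + 1)

theorem IsRecurrenceSolution.isFormalSolution {α β : ℕ → ℝ} {P : ℕ → ℝ[X]}
    (hP : IsRecurrenceSolution α β P) (x : ℂ) :
    IsFormalSolution α β x fun k => aeval x (P k) := by
  intro k
  have h := congrArg (aeval x) (hP.recurrence k)
  simp only [map_mul, map_sub, aeval_C, aeval_X, Complex.coe_algebraMap] at h
  simp only [jacobiAction]
  linear_combination h

namespace IsFormalSolution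

variable {α β : ℕ → ℝ} {x : ℂ} {v w : ℕ → ℂ}

theorem linear_comb (hv : IsFormalSolution α β x v) (hw : IsFormalSolution α β x w) (c d : ℂ) :
    IsFormalSolution α β x fun k => c * v k + d * w k := by
  intro k
  have h1 := hv k
  have h2 := hw k
  simp only [jacobiAction] at h1 h2 ⊢
  linear_combination c * h1 + d * h2

theorem ext (hβ : ∀ k, 0 < β k) (hv : IsFormalSolution α β x v) (hw : IsFormalSolution α β x w)
    (h0 : v 0 = w 0) (h1 : v 1 = w 1) : v = w := by
  funext k
  induction k using Nat.twoStepInduction with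
  | zero => exact h0
  | one => exact h1
  | more k ih1 ih2 =>
    have hb : (β (k + 1) : ℂ) ≠ 0 := Complex.ofReal_ne_zero.2 (hβ _).ne'
    have e1 := hv k
    have e2 := hw k
    simp only [jacobiAction, ih1, ih2] at e1 e2
    exact mul_left_cancel₀ hb (by linear_combination e1 - e2)

/-- The recurrence runs backwards because `β N ≠ 0`; row `1` already determines `w 0`, so the first
row is not needed. -/
theorem eq_zero_of_eventually (hβ : ∀ k, 0 < β k) (hw : IsFormalSolution α β x w) {N : ℕ}
    (h : ∀ k, N ≤ k → w k = 0) : w = 0 := by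
  induction N with
  | zero => exact funext fun k => h k k.zero_le
  | succ N ih =>
    refine ih fun k hk => ?_
    rcases hk.eq_or_lt with rfl | hk
    · have e := hw N
      simp only [jacobiAction, h (N + 1) le_rfl, h (N + 2) (by omega), mul_zero, add_zero] at e
      exact (mul_eq_zero.1 e).resolve_left (Complex.ofReal_ne_zero.2 (hβ _).ne')
    · exact h k hk

theorem wronskian (hv : IsFormalSolution α β x v) (hw : IsFormalSolution α β x w) (k : ℕ) :
    β k * (v k * w (k + 1) - v (k + 1) * w k) = β 0 * (v 0 * w 1 - v 1 * w 0) := by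
  induction k with
  | zero => rfl
  | succ k ih =>
    have e1 := hv k
    have e2 := hw k
    simp only [jacobiAction] at e1 e2
    linear_combination ih + v (k + 1) * e2 - w (k + 1) * e1

theorem isPerturbedGeometricAt {z : ℂ} (hz : z ≠ 0)
    (hw : IsFormalSolution α β (joukowski z) w) :
    IsPerturbedGeometricAt (fun k => -(2 * α (k + 1))) (fun k => 1 - (2 * β k) ^ 2) z
      fun k => offDiagProd β k * (z ^ k * w k) := by
  intro k
  have h := hw k
  simp only [jacobiAction] at h
  have hx : 1 + z ^ 2 = 2 * z * joukowski z := by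
    rw [joukowski]
    field_simp
    ring
  simp only [offDiagProd_succ]
  push_cast
  linear_combination (offDiagProd β k : ℂ) * (2 * β k) * z ^ (k + 2) * 2 * h
    + (offDiagProd β k : ℂ) * (2 * β k) * z ^ (k + 1) * w (k + 1) * (-hx)

theorem tendsto_offDiagProd_mul (hβ : ∀ k, 0 < β k) (hJ : IsToeplitzPlusTraceClass α β)
    {q : ℕ → ℂ} (hq : Tendsto q atTop (𝓝 0)) :
    Tendsto (fun k => offDiagProd β k * q k) atTop (𝓝 0) := by
  obtain ⟨l, -, hl⟩ := hJ.exists_tendsto_offDiagProd hβ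
  simpa using ((Complex.continuous_ofReal.tendsto l).comp hl).mul hq

/-- Once the dominant `z^(-k)` part of `w` is absent, `z ^ k * w k` decays at least like `‖z‖ ^ k`.
-/
theorem exists_norm_le {z : ℂ} (hβ : ∀ k, 0 < β k) (hJ : IsToeplitzPlusTraceClass α β)
    (hz0 : z ≠ 0) (hz1 : ‖z‖ < 1) (hw : IsFormalSolution α β (joukowski z) w)
    (hlim : Tendsto (fun k => z ^ k * w k) atTop (𝓝 0)) : ∃ M, ∀ k, ‖w k‖ ≤ M := by
  obtain ⟨M, hM⟩ := (hw.isPerturbedGeometricAt hz0).exists_norm_le_pow hJ.summable_perturbation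
    hz0 hz1 (tendsto_offDiagProd_mul hβ hJ hlim)
  obtain ⟨l, hl, hA⟩ := hJ.exists_tendsto_offDiagProd hβ
  obtain ⟨K, hK⟩ := (hA.inv₀ hl.ne').bddAbove_range
  have hM0 : 0 ≤ M := by simpa using (norm_nonneg _).trans (hM 0)
  refine ⟨K * M, fun k => ?_⟩
  have h := hM k
  rw [norm_mul, norm_mul, norm_pow, Complex.norm_real, Real.norm_eq_abs,
    abs_of_pos (offDiagProd_pos hβ k), mul_left_comm, mul_comm M] at h
  have h2 := le_of_mul_le_mul_left h (pow_pos (norm_pos_iff.2 hz0) k)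
  rw [mul_comm, ← le_div_iff₀ (offDiagProd_pos hβ k), div_eq_inv_mul] at h2
  exact h2.trans (mul_le_mul_of_nonneg_right (hK ⟨k, rfl⟩) hM0)

theorem eq_zero_of_tendsto {z : ℂ} (hβ : ∀ k, 0 < β k) (hJ : IsToeplitzPlusTraceClass α β)
    (hz1 : ‖z‖ = 1) (hz2 : z ^ 2 ≠ 1) (hw : IsFormalSolution α β (joukowski z) w)
    (hlim : Tendsto w atTop (𝓝 0)) : w = 0 := by
  have hz0 : z ≠ 0 := norm_pos_iff.1 (by rw [hz1]; exact one_pos)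
  have hlim' : Tendsto (fun k => z ^ k * w k) atTop (𝓝 0) := by
    rw [tendsto_zero_iff_norm_tendsto_zero] at hlim ⊢
    simpa [hz1] using hlim
  obtain ⟨N, hN⟩ := (hw.isPerturbedGeometricAt hz0).eventually_eq_zero hJ.summable_perturbation
    hz1 hz2 (tendsto_offDiagProd_mul hβ hJ hlim')
  refine hw.eq_zero_of_eventually hβ (N := N) fun k hk => ?_
  have hA : (offDiagProd β k : ℂ) ≠ 0 := Complex.ofReal_ne_zero.2 (offDiagProd_pos hβ k).ne'
  exact (mul_eq_zero.1 ((mul_eq_zero.1 (hN k hk)).resolve_left hA)).resolve_left (pow_ne_zero k hz0)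

end IsFormalSolution

/-! ### From the operator to the symbols: resolvent and eigenvalues. -/

theorem exists_joukowski_eq (x : ℂ) : ∃ z : ℂ, z ≠ 0 ∧ ‖z‖ ≤ 1 ∧ joukowski z = x := by
  obtain ⟨s, hs⟩ := IsAlgClosed.exists_pow_nat_eq (x ^ 2 - 1) (n := 2) two_pos
  -- The two preimages of `x` are mutually inverse, so one of them lies in the closed disc.
  have hmul : (x + s) * (x - s) = 1 := by linear_combination -hs
  have h1 : (x + s)⁻¹ = x - s := inv_eq_of_mul_eq_one_right hmul
  have h2 : (x - s)⁻¹ = x + s := inv_eq_of_mul_eq_one_left hmul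
  rcases le_total ‖x + s‖ 1 with h | h
  · refine ⟨x + s, left_ne_zero_of_mul_eq_one hmul, h, ?_⟩
    rw [joukowski, h1]
    ring
  · refine ⟨x - s, right_ne_zero_of_mul_eq_one hmul, ?_, ?_⟩
    · rw [← h1, norm_inv]
      exact inv_le_one_of_one_le₀ h
    · rw [joukowski, h2]
      ring

theorem tendsto_lp_zero (v : lp (fun _ : ℕ => ℂ) 2) : Tendsto (fun k => v k) atTop (𝓝 0) := by
  have h := ((memlp_two_iff v).1 (lp.memℓp v)).tendsto_atTop_zero.sqrt
  rw [tendsto_zero_iff_norm_tendsto_zero]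
  simpa only [Real.sqrt_sq (norm_nonneg _), Real.sqrt_zero] using h

theorem aeval_orthPoly_zero (α β : ℕ → ℝ) (x : ℂ) : aeval x (orthPoly α β 0) = 1 := by
  simp [orthPoly]

theorem mul_aeval_orthPoly_one {α β : ℕ → ℝ} (hβ : ∀ k, 0 < β k) (x : ℂ) :
    (β 0 : ℂ) * aeval x (orthPoly α β 1) = x - α 0 := by
  have h := congrArg (aeval x) (C_mul_C_inv_mul (hβ 0) (X - C (α 0)))
  simpa [orthPoly] using h

theorem aeval_assocPoly_zero (α β : ℕ → ℝ) (x : ℂ) : aeval x (assocPoly α β 0) = 0 := by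
  simp [assocPoly]

theorem mul_aeval_assocPoly_one {α β : ℕ → ℝ} (hβ : ∀ k, 0 < β k) (x : ℂ) :
    (β 0 : ℂ) * aeval x (assocPoly α β 1) = 1 := by
  have hb : (β 0 : ℂ) ≠ 0 := Complex.ofReal_ne_zero.2 (hβ _).ne'
  simp [assocPoly, hb]

/-- A solution of `(J - x) v = c e_0` is `v = v_0 P + c P^μ`. -/
theorem IsFormalSolution.eq_orthPoly_add_assocPoly {α β : ℕ → ℝ} (hβ : ∀ k, 0 < β k) {x c : ℂ}
    {v : ℕ → ℂ} (hv : IsFormalSolution α β x v) (h0 : jacobiAction α β v 0 - x * v 0 = c) (k : ℕ) :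
    v k = v 0 * aeval x (orthPoly α β k) + c * aeval x (assocPoly α β k) := by
  have hb : (β 0 : ℂ) ≠ 0 := Complex.ofReal_ne_zero.2 (hβ _).ne'
  refine congrFun (hv.ext hβ (((isRecurrenceSolution_orthPoly hβ).isFormalSolution x).linear_comb
    ((isRecurrenceSolution_assocPoly hβ).isFormalSolution x) (v 0) c) ?_ ?_) k
  · rw [aeval_orthPoly_zero, aeval_assocPoly_zero]
    ring
  · simp only [jacobiAction] at h0
    exact mul_left_cancel₀ hb (by
      linear_combination h0 - v 0 * mul_aeval_orthPoly_one (α := α) hβ x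
        - c * mul_aeval_assocPoly_one (α := α) hβ x)

/-- The symbol of `v_0 C + c C^μ` vanishes for every `ℓ²` solution of `(J - x) v = c e_0`. -/
theorem toeplitzSymbol_relation {α β : ℕ → ℝ} (hβ : ∀ k, 0 < β k)
    (hJ : IsToeplitzPlusTraceClass α β) {z c : ℂ} (hz : z ∈ Metric.ball (0 : ℂ) 1) (hz0 : z ≠ 0)
    {v : ℕ → ℂ} (hv : IsFormalSolution α β (joukowski z) v)
    (h0 : jacobiAction α β v 0 - joukowski z * v 0 = c) (hlim : Tendsto v atTop (𝓝 0)) :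
    v 0 * toeplitzSymbol (connC α β) z + c * toeplitzSymbol (connCmu α β) z = 0 := by
  have h1 := (isRecurrenceSolution_orthPoly hβ).tendsto_toeplitzSymbol hβ hJ hz hz0
  have h2 := (isRecurrenceSolution_assocPoly hβ).tendsto_toeplitzSymbol hβ hJ hz hz0
  have h3 : Tendsto (fun k => (1 - z ^ 2) * (z ^ k * v k)) atTop (𝓝 0) := by
    simpa using ((tendsto_pow_atTop_nhds_zero_of_norm_lt_one
      (mem_ball_zero_iff.1 hz)).mul hlim).const_mul (1 - z ^ 2)
  refine tendsto_nhds_unique ((h1.const_mul (v 0)).add (h2.const_mul c)) (h3.congr fun k => ?_)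
  rw [hv.eq_orthPoly_add_assocPoly hβ h0 k]
  ring

theorem sub_sq_ne_zero {z : ℂ} (hz : z ∈ Metric.ball (0 : ℂ) 1) : 1 - z ^ 2 ≠ 0 := fun h => by
  have h1 : ‖z‖ ^ 2 = 1 := by rw [← norm_pow, ← sub_eq_zero.1 h, norm_one]
  have h2 := mem_ball_zero_iff.1 hz
  nlinarith [norm_nonneg z]

/-- By constancy of the Wronskian, `c` does not vanish where `(J - λ(z)) v = e_0` is solvable. -/
theorem toeplitzSymbol_connC_ne_zero {α β : ℕ → ℝ} (hβ : ∀ k, 0 < β k)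
    (hJ : IsToeplitzPlusTraceClass α β) {z : ℂ} (hz : z ∈ Metric.ball (0 : ℂ) 1) (hz0 : z ≠ 0)
    {v : ℕ → ℂ} (hv : IsFormalSolution α β (joukowski z) v)
    (h0 : jacobiAction α β v 0 - joukowski z * v 0 = 1) (hlim : Tendsto v atTop (𝓝 0)) :
    toeplitzSymbol (connC α β) z ≠ 0 := by
  intro hc
  set w : ℕ → ℂ := fun k => aeval (joukowski z) (orthPoly α β k)
  have hw : IsFormalSolution α β (joukowski z) w :=
    (isRecurrenceSolution_orthPoly hβ).isFormalSolution _
  have hw_lim : Tendsto (fun k => z ^ k * w k) atTop (𝓝 0) := by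
    have h := (isRecurrenceSolution_orthPoly hβ).tendsto_toeplitzSymbol hβ hJ hz hz0
    rw [connC] at hc
    rw [hc] at h
    have h' := h.const_mul (1 - z ^ 2)⁻¹
    rw [mul_zero] at h'
    exact h'.congr fun k => inv_mul_cancel_left₀ (sub_sq_ne_zero hz) _
  obtain ⟨M, hM⟩ := hw.exists_norm_le hβ hJ hz0 (mem_ball_zero_iff.1 hz) hw_lim
  obtain ⟨B, hB⟩ := hJ.boundedCoeffs
  have hw_bdd : ∀ i, IsBoundedUnder (· ≤ ·) atTop (norm ∘ fun k => w (k + i)) := fun i =>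
    isBoundedUnder_of ⟨M, fun k => hM (k + i)⟩
  have hβ_bdd : IsBoundedUnder (· ≤ ·) atTop (norm ∘ fun k => (β k : ℂ)) :=
    isBoundedUnder_of ⟨B, fun k => by
      rw [Function.comp_apply, Complex.norm_real, Real.norm_eq_abs]
      exact (hB k).2⟩
  -- Boundedness of `w` suffices here, because `v` tends to `0`.
  have hW : Tendsto (fun k => β k * (v k * w (k + 1) - v (k + 1) * w k)) atTop (𝓝 0) := by
    refine isBoundedUnder_le_mul_tendsto_zero hβ_bdd ?_
    simpa using (hlim.zero_mul_isBoundedUnder_le (hw_bdd 1)).sub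
      (((tendsto_add_atTop_iff_nat 1).2 hlim).zero_mul_isBoundedUnder_le (hw_bdd 0))
  have hW0 : (β 0 : ℂ) * (v 0 * w 1 - v 1 * w 0) = -1 := by
    have e1 := mul_aeval_orthPoly_one (α := α) hβ (joukowski z)
    have e2 : w 0 = 1 := aeval_orthPoly_zero α β _
    simp only [jacobiAction] at h0
    rw [e2]
    linear_combination v 0 * e1 - h0
  have h := tendsto_nhds_unique (hW.congr fun k => (hv.wronskian hw k).trans hW0)
    tendsto_const_nhds
  norm_num at h

theorem principalResolvent_eq_apply_zero (J : lp (fun _ : ℕ => ℂ) 2 →L[ℂ] lp (fun _ : ℕ => ℂ) 2)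
    (x : ℂ) : principalResolvent J x = Ring.inverse (J - algebraMap ℂ _ x) e0 0 := by
  rw [principalResolvent]
  conv_lhs => rw [e0]
  rw [lp.inner_single_left]
  simp
  rfl

theorem exists_resolvent_solution {α β : ℕ → ℝ} (h : BoundedCoeffs α β) {x : ℂ}
    (hx : x ∉ spectrum ℂ (jacobiOperator α β h)) :
    ∃ v : ℕ → ℂ, IsFormalSolution α β x v ∧ jacobiAction α β v 0 - x * v 0 = 1 ∧
      Tendsto v atTop (𝓝 0) ∧ principalResolvent (jacobiOperator α β h) x = v 0 := by
  -- Off the spectrum `Ring.inverse` is the true inverse, not its default value `0`.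
  have hu : IsUnit (jacobiOperator α β h - algebraMap ℂ _ x) :=
    IsUnit.sub_iff.1 (spectrum.notMem_iff.1 hx)
  set u : lp (fun _ : ℕ => ℂ) 2 :=
    Ring.inverse (jacobiOperator α β h - algebraMap ℂ _ x) e0
  have h1 : (jacobiOperator α β h - algebraMap ℂ _ x) u = e0 :=
    DFunLike.congr_fun (Ring.mul_inverse_cancel _ hu) e0
  have h2 : ∀ k, jacobiAction α β u k - x * u k = e0 k := fun k => by
    rw [← h1]
    rfl
  refine ⟨u, fun k => ?_, ?_, tendsto_lp_zero u, principalResolvent_eq_apply_zero _ _⟩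
  · have h3 := h2 (k + 1)
    rw [show e0 (k + 1) = 0 by simp [e0]] at h3
    exact sub_eq_zero.1 h3
  · rw [h2, e0]
    simp

theorem exists_root_of_hasEigenvalue {α β : ℕ → ℝ} (hβ : ∀ k, 0 < β k)
    (hJ : IsToeplitzPlusTraceClass α β) {x : ℂ}
    (hx : Module.End.HasEigenvalue (jacobiOperator α β hJ.boundedCoeffs).toLinearMap x)
    (h1 : x ≠ 1) (h2 : x ≠ -1) :
    ∃ z ∈ Metric.ball (0 : ℂ) 1, z ≠ 0 ∧ toeplitzSymbol (connC α β) z = 0 ∧ x = joukowski z := by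
  obtain ⟨u, hu⟩ := hx.exists_hasEigenvector
  obtain ⟨z, hz0, hz1, rfl⟩ := exists_joukowski_eq x
  have hJu : ∀ k, jacobiAction α β u k = joukowski z * u k := fun k =>
    congrArg (fun v : lp (fun _ : ℕ => ℂ) 2 => v k) hu.apply_eq_smul
  have hsol : IsFormalSolution α β (joukowski z) u := fun k => hJu (k + 1)
  have hne : (u : ℕ → ℂ) ≠ 0 := fun h => hu.2 (lp.ext h)
  have hlt : ‖z‖ < 1 := by
    refine hz1.lt_of_ne fun hz => hne (hsol.eq_zero_of_tendsto hβ hJ hz (fun hsq => ?_)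
      (tendsto_lp_zero u))
    rcases eq_or_eq_neg_of_sq_eq_sq z 1 (hsq.trans (one_pow 2).symm) with rfl | rfl
    · exact h1 (by norm_num [joukowski])
    · exact h2 (by norm_num [joukowski])
  have hzb : z ∈ Metric.ball (0 : ℂ) 1 := mem_ball_zero_iff.2 hlt
  have h0 : jacobiAction α β u 0 - joukowski z * u 0 = 0 := sub_eq_zero.2 (hJu 0)
  -- An eigenvector is `u 0` times the sequence of orthonormal polynomials at the eigenvalue.
  have hu0 : u 0 ≠ 0 := fun h => hne (funext fun k => by
    rw [hsol.eq_orthPoly_add_assocPoly hβ h0 k, h, zero_mul, zero_mul, add_zero, Pi.zero_apply])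
  have h := toeplitzSymbol_relation hβ hJ hzb hz0 hsol h0 (tendsto_lp_zero u)
  rw [zero_mul, add_zero] at h
  exact ⟨z, hzb, hz0, (mul_eq_zero.1 h).resolve_left hu0, rfl⟩

theorem theorem5p12 (α β : ℕ → ℝ) (hβ : ∀ k, 0 < β k)
    (hJ : IsToeplitzPlusTraceClass α β) :
    -- the Toeplitz parts of `C` and `C^μ` exist
    (∀ k, Tendsto (fun i => connC α β i (i + k)) atTop (𝓝 (toeplitzCoeff (connC α β) k))) ∧
    (∀ k, Tendsto (fun i => connCmu α β i (i + k)) atTop (𝓝 (toeplitzCoeff (connCmu α β) k))) ∧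
    -- their symbols `c` and `c_μ` are given by convergent series and are analytic in the disc
    (∀ z ∈ Metric.ball (0 : ℂ) 1, Summable fun k => (toeplitzCoeff (connC α β) k : ℂ) * z ^ k) ∧
    (∀ z ∈ Metric.ball (0 : ℂ) 1, Summable fun k => (toeplitzCoeff (connCmu α β) k : ℂ) * z ^ k) ∧
    AnalyticOnNhd ℂ (toeplitzSymbol (connC α β)) (Metric.ball 0 1) ∧
    AnalyticOnNhd ℂ (toeplitzSymbol (connCmu α β)) (Metric.ball 0 1) ∧
    -- the principal resolvent in the disc is the meromorphic function `-c_μ / c`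
    MeromorphicOn (fun z => -(toeplitzSymbol (connCmu α β) z / toeplitzSymbol (connC α β) z))
      (Metric.ball 0 1) ∧
    (∀ z ∈ Metric.ball (0 : ℂ) 1, z ≠ 0 →
      joukowski z ∉ spectrum ℂ (jacobiOperator α β hJ.boundedCoeffs) →
      toeplitzSymbol (connC α β) z ≠ 0 ∧
      principalResolvent (jacobiOperator α β hJ.boundedCoeffs) (joukowski z) =
        -(toeplitzSymbol (connCmu α β) z / toeplitzSymbol (connC α β) z)) ∧
    -- the eigenvalues, the end points `±1` of the continuous spectrum apart, come from roots of `c`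
    (∀ x : ℂ,
      Module.End.HasEigenvalue
        (jacobiOperator α β hJ.boundedCoeffs).toLinearMap x →
      x ≠ 1 → x ≠ -1 →
      ∃ z ∈ Metric.ball (0 : ℂ) 1, z ≠ 0 ∧ toeplitzSymbol (connC α β) z = 0 ∧
        x = joukowski z) := by
  have hP := isRecurrenceSolution_orthPoly (α := α) hβ
  have hQ := isRecurrenceSolution_assocPoly (α := α) hβ
  have hc := hP.analyticOnNhd_toeplitzSymbol hβ hJ
  have hcmu := hQ.analyticOnNhd_toeplitzSymbol hβ hJ
  refine ⟨hP.tendsto_connectionMatrix hβ hJ, hQ.tendsto_connectionMatrix hβ hJ,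
    fun z hz => hP.summable_toeplitzCoeff hβ hJ hz, fun z hz => hQ.summable_toeplitzCoeff hβ hJ hz,
    hc, hcmu, (hcmu.meromorphicOn.fun_div hc.meromorphicOn).fun_neg, fun z hz hz0 hspec => ?_,
    fun x hx h1 h2 => exists_root_of_hasEigenvalue hβ hJ hx h1 h2⟩
  obtain ⟨v, hv, h0, hlim, hG⟩ := exists_resolvent_solution hJ.boundedCoeffs hspec
  have hne := toeplitzSymbol_connC_ne_zero hβ hJ hz hz0 hv h0 hlim
  refine ⟨hne, ?_⟩
  have h := toeplitzSymbol_relation hβ hJ hz hz0 hv h0 hlim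
  rw [hG, ← neg_div, eq_div_iff hne]
  linear_combination h
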